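/- Let $q>1$ be an odd integer, and let $R$ be an integral domain (commutative, with $1\neq 0$) that is not isomorphic to $\mathbb{F}_3$, $\mathbb{F}_5$ or $\mathbb{F}_9$. For $n\ge 1$ let $\mathbb{M}_n(R)$ be the ring of $n\times n$ matrices over $R$. An element $x$ of a ring is called $q$-potent if $x^q=x$, tripotent if $x^3=x$, idempotent if $x^2=x$, and nilpotent if $x^j=0$ for some $j\ge 1$. Then the following statements are equivalent; moreover, each of (1)–(4) may be read either with "for each integer $n\ge 1$" or with "for some integer $n\ge 1$", and all the resulting statements are equivalent. 1. For each (for some) $n\ge 1$, every matrix in $\mathbb{M}_n(R)$ is the sum of an idempotent matrix and a $q$-potent matrix. 2. For each (for some) $n\ge 1$, every matrix in $\mathbb{M}_n(R)$ is the sum of a nilpotent matrix and a $q$-potent matrix. 3. For each (for some) $n\ge 1$, every matrix in $\mathbb{M}_n(R)$ is the sum of a tripotent matrix and a $q$-potent matrix. 4. For each (for some) $n\ge 1$, every matrix in $\mathbb{M}_n(R)$ is of the form $B+E$ or $B-E$ with $B\in\mathbb{M}_n(R)$ a $q$-potent matrix and $E\in\mathbb{M}_n(R)$ an idempotent matrix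 (the sign may depend on the matrix). 5. Every element of $R$ is the sum of a $q$-potent and a tripotent of $R$. 6. Every element of $R$ is of the form $b+e$ or $b-e$ with $b\in R$ a $q$-potent and $e\in R$ an idempotent (the sign may depend on the element). 7. $R$ is a finite field such that $(|R|-1)\mid(q-1)$. -/

import Mathlib

/-- `x` is `q`-potent if `x ^ q = x`; tripotent means `3`-potent. -/
def IsPotentOf {A : Type*} [Monoid A] (q : ℕ) (x : A) : Prop :=
  x ^ q = x

/-- Every element of `A` is the sum of an idempotent and a `q`-potent. -/
def AllIdempotentAddPotent (A : Type*) [Ring A] (q : ℕ) : Prop :=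
  ∀ a : A, ∃ e b : A, IsIdempotentElem e ∧ IsPotentOf q b ∧ a = e + b

/-- Every element of `A` is the sum of a nilpotent and a `q`-potent. -/
def AllNilpotentAddPotent (A : Type*) [Ring A] (q : ℕ) : Prop :=
  ∀ a : A, ∃ d b : A, IsNilpotent d ∧ IsPotentOf q b ∧ a = d + b

/-- Every element of `A` is the sum of a tripotent and a `q`-potent. -/
def AllTripotentAddPotent (A : Type*) [Ring A] (q : ℕ) : Prop :=
  ∀ a : A, ∃ t b : A, IsPotentOf 3 t ∧ IsPotentOf q b ∧ a = t + b

/-- Every element of `A` is `b + e` or `b - e` for some `q`-potent `b` and some idempotent `e`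
(the choice of sign may depend on the element). -/
def AllPotentAddOrSubIdempotent (A : Type*) [Ring A] (q : ℕ) : Prop :=
  ∀ a : A, ∃ b e : A, IsPotentOf q b ∧ IsIdempotentElem e ∧ (a = b + e ∨ a = b - e)

/-! All the conditions pass through the tripotent condition on `R` itself. A tripotent or nilpotent
matrix over a domain has an eigenvector with eigenvalue in {0, 1, -1}; decomposing a scalar matrix
`a • 1` and evaluating at this eigenvector decomposes `a` in `R`.

From the scalar condition to the field: `R` is finite, because it is a sumset of two root sets,
hence it is a field F. The nonzero `q`-potents form a subgroup H of Fˣ containing -1 (`q` is odd),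
and every nonzero x outside H has a neighbour x + 1 or x - 1 in H. Counting gives index at most 2.
Index 1 is the divisibility |F| - 1 ∣ q - 1. Index 2 is so rigid that |F| is 5 or 9
(`card_eq_five_or_nine`), and these fields are excluded.

From the field to matrices: every matrix is a direct sum of multiplications by X on cyclic modules
F[X]/(p). A Newton basis makes such a block lower bidiagonal outside its last column, with a
diagonal that is free apart from its trace (`exists_newton_chain`). Subdiagonal entries are shared
out between N and D so that N is idempotent or nilpotent, while D is killed by a product of linear
factors dividing X ^ q - X (`hasSplit_of_diagonal`). It remains to choose diagonals with the right
trace; this needs more than three elements or characteristic 2, hence the exclusion of the field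
with 3 elements. -/

/-! ### Subgroups of index two in which every outside element has a neighbour. -/

/-- A multiplicatively closed set of nonzero elements with exactly one other coset, such that every
element of the other coset is adjacent to the set. -/
structure IsAdjacentHalf {F : Type*} [Field F] (H : F → Prop) : Prop where
  not_zero : ¬ H 0
  neg_one : H (-1)
  mul : ∀ {x y}, H x → H y → H (x * y)
  inv : ∀ {x}, H x → H x⁻¹
  compl_mul : ∀ {x y}, x ≠ 0 → y ≠ 0 → ¬ H x → ¬ H y → H (x * y)
  adj : ∀ {x}, x ≠ 0 → ¬ H x → H (x + 1) ∨ H (x - 1)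

namespace IsAdjacentHalf

variable {F : Type*} [Field F] {H : F → Prop}

/-- The other coset. -/
def Off (H : F → Prop) (x : F) : Prop := x ≠ 0 ∧ ¬ H x

theorem mem_or_off {x : F} (hx : x ≠ 0) : H x ∨ Off H x := by
  by_cases h : H x
  · exact Or.inl h
  · exact Or.inr ⟨hx, h⟩

variable (hH : IsAdjacentHalf H)
include hH

theorem one : H 1 := by
  simpa using hH.mul hH.neg_one hH.neg_one

theorem ne_zero {x : F} (hx : H x) : x ≠ 0 := fun h => hH.not_zero (h ▸ hx)

theorem neg {x : F} (hx : H x) : H (-x) := by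
  simpa using hH.mul hH.neg_one hx

theorem off_mul_mem {x y : F} (hx : Off H x) (hy : H y) : Off H (x * y) := by
  refine ⟨mul_ne_zero hx.1 (hH.ne_zero hy), fun h => hx.2 ?_⟩
  simpa [mul_assoc, hH.ne_zero hy] using hH.mul h (hH.inv hy)

theorem off_mul_off {x y : F} (hx : Off H x) (hy : Off H y) : H (x * y) :=
  hH.compl_mul hx.1 hy.1 hx.2 hy.2

theorem off_inv {x : F} (hx : Off H x) : Off H x⁻¹ :=
  ⟨inv_ne_zero hx.1, fun h => hx.2 (by simpa using hH.inv h)⟩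

theorem off_neg {x : F} (hx : Off H x) : Off H (-x) := by
  simpa using hH.off_mul_mem hx hH.neg_one

theorem off_add_one_ne {x : F} (hx : Off H x) : x + 1 ≠ 0 := fun h =>
  hx.2 (by rw [eq_neg_of_add_eq_zero_left h]; exact hH.neg_one)

-- Inversion exchanges the two sets: x⁻¹ + 1 = x⁻¹ * (x + 1), and multiplying by x⁻¹ switches
-- cosets. Together they exhaust the other coset, since x + 1 = 0 would put x = -1 in `H`.
open Classical in
theorem two_mul_card_off_pair [Fintype F] :
    2 * (Finset.univ.filter fun x => Off H x ∧ Off H (x + 1)).card =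
      (Finset.univ.filter fun x => Off H x).card ∧
    2 * (Finset.univ.filter fun x => Off H x ∧ H (x + 1)).card =
      (Finset.univ.filter fun x => Off H x).card := by
  have hsum : (Finset.univ.filter fun x => Off H x ∧ Off H (x + 1)).card +
      (Finset.univ.filter fun x => Off H x ∧ H (x + 1)).card =
      (Finset.univ.filter fun x => Off H x).card := by
    rw [← Finset.card_union_of_disjoint]
    · congr 1
      ext x
      simp only [Finset.mem_union, Finset.mem_filter, Finset.mem_univ, true_and]
      constructor
      · rintro (h | h) <;> exact h.1
      · intro h
        rcases mem_or_off (hH.off_add_one_ne h) with h1 | h1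
        · exact Or.inr ⟨h, h1⟩
        · exact Or.inl ⟨h, h1⟩
    · rw [Finset.disjoint_filter]
      rintro x - h h'
      exact h.2.2 h'.2
  have heq : (Finset.univ.filter fun x => Off H x ∧ Off H (x + 1)).card =
      (Finset.univ.filter fun x => Off H x ∧ H (x + 1)).card := by
    have key : ∀ x : F, x ≠ 0 → x⁻¹ + 1 = x⁻¹ * (x + 1) := by
      intro x hx
      field_simp
      ring
    refine Finset.card_bij' (fun x _ => x⁻¹) (fun x _ => x⁻¹) ?_ ?_ ?_ ?_
    · intro x hx
      simp only [Finset.mem_filter, Finset.mem_univ, true_and] at hx ⊢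
      refine ⟨hH.off_inv hx.1, ?_⟩
      rw [key x hx.1.1]
      exact hH.off_mul_off (hH.off_inv hx.1) hx.2
    · intro x hx
      simp only [Finset.mem_filter, Finset.mem_univ, true_and] at hx ⊢
      refine ⟨hH.off_inv hx.1, ?_⟩
      rw [key x hx.1.1]
      exact hH.off_mul_mem (hH.off_inv hx.1) hx.2
    · simp
    · simp
  omega

/-- By the preceding count and the symmetry x ↦ -x, the x with x + 1 in `H` and those with x - 1 in
`H` each make up half of the other coset. Adjacency says that they cover it, so they are disjoint.
The other coset thus splits into isolated pairs {x, x + 1}. -/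
theorem off_add_one_iff [Finite F] {x : F} (hx : Off H x) :
    Off H (x + 1) ↔ ¬ Off H (x - 1) := by
  classical
  have := Fintype.ofFinite F
  constructor
  · intro h h'
    rcases hH.adj hx.1 hx.2 with h1 | h1
    · exact h.2 h1
    · exact h'.2 h1
  · intro h'
    by_contra h
    have h1 : H (x + 1) := (mem_or_off (hH.off_add_one_ne hx)).resolve_right h
    have hx1 : x - 1 ≠ 0 := fun h0 => hx.2 (by rw [sub_eq_zero.1 h0]; exact hH.one)
    have h2 : H (x - 1) := (mem_or_off hx1).resolve_right h'
    set A := Finset.univ.filter fun x => Off H x ∧ H (x + 1) with hA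
    set B := Finset.univ.filter fun x => Off H x ∧ H (x - 1) with hB
    have hBA : B.card = A.card := by
      refine Finset.card_bij' (fun x _ => -x) (fun x _ => -x) ?_ ?_ ?_ ?_
      · intro x hx
        simp only [hA, hB, Finset.mem_filter, Finset.mem_univ, true_and] at hx ⊢
        refine ⟨hH.off_neg hx.1, ?_⟩
        have := hH.neg hx.2
        rwa [neg_sub, sub_eq_neg_add] at this
      · intro x hx
        simp only [hA, hB, Finset.mem_filter, Finset.mem_univ, true_and] at hx ⊢
        refine ⟨hH.off_neg hx.1, ?_⟩
        have := hH.neg hx.2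
        rwa [neg_add, ← sub_eq_add_neg] at this
      · simp
      · simp
    have hU : A ∪ B = Finset.univ.filter fun x => Off H x := by
      ext y
      simp only [hA, hB, Finset.mem_union, Finset.mem_filter, Finset.mem_univ, true_and]
      constructor
      · rintro (h | h) <;> exact h.1
      · intro h
        rcases hH.adj h.1 h.2 with h3 | h3
        · exact Or.inl ⟨h, h3⟩
        · exact Or.inr ⟨h, h3⟩
    have hc := Finset.card_union_add_card_inter A B
    have hA2 : 2 * A.card = _ := hH.two_mul_card_off_pair.2
    rw [hU, hBA, ← hA2] at hc
    have hI : (A ∩ B).card = 0 := by omega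
    have : x ∈ A ∩ B := by simp [hA, hB, hx, h1, h2]
    simp_all

theorem off_add_iff [Finite F] {x h : F} (hx : Off H x) (hh : H h) :
    Off H (x + h) ↔ ¬ Off H (x - h) := by
  have h0 := hH.ne_zero hh
  have scale : ∀ y, Off H (y * h⁻¹) ↔ Off H y := fun y =>
    ⟨fun hy => by simpa [mul_assoc, h0] using hH.off_mul_mem hy hh,
      fun hy => hH.off_mul_mem hy (hH.inv hh)⟩
  have := hH.off_add_one_iff ((scale x).2 hx)
  have e1 : x * h⁻¹ + 1 = (x + h) * h⁻¹ := by field_simp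
  have e2 : x * h⁻¹ - 1 = (x - h) * h⁻¹ := by field_simp
  rwa [e1, e2, scale, scale] at this

theorem exists_off_pair [Finite F] (hne : ∃ x, Off H x) : ∃ x, Off H x ∧ Off H (x + 1) := by
  obtain ⟨x, hx⟩ := hne
  by_cases h : Off H (x + 1)
  · exact ⟨x, hx, h⟩
  · refine ⟨x - 1, ?_, by simpa using hx⟩
    by_contra h'
    exact h ((hH.off_add_one_iff hx).2 h')

theorem two_ne_zero' [Finite F] (hne : ∃ x, Off H x) : (2 : F) ≠ 0 := by
  obtain ⟨x, hx⟩ := hne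
  intro h2
  have := hH.off_add_one_iff hx
  rw [show x + 1 = x - 1 by linear_combination h2] at this
  tauto

theorem not_off_sub_one [Finite F] {x : F} (hx : Off H x) (hx1 : Off H (x + 1)) :
    ¬ Off H (x - 1) := (hH.off_add_one_iff hx).1 hx1

theorem not_off_add_two [Finite F] {x : F} (hx : Off H x) (hx1 : Off H (x + 1)) :
    ¬ Off H (x + 2) := by
  intro h
  refine (hH.off_add_one_iff hx1).1 ?_ (by simpa using hx)
  rwa [add_assoc, one_add_one_eq_two]

/-- With 2 in `H`, the dichotomy for steps of 2 carries a pair {x, x + 1} to the pair {x + 3, x +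
4}. Walking around the prime field in steps of 3 then produces a forbidden neighbour of the first
pair, unless the characteristic is 3. -/
theorem three_eq_zero_of_mem_two [Finite F] (hne : ∃ x, Off H x) (h2 : H 2) : (3 : F) = 0 := by
  obtain ⟨x, hx, hx1⟩ := hH.exists_off_pair hne
  have step : ∀ y, Off H y → Off H (y + 1) → Off H (y + 3) ∧ Off H (y + 4) := by
    intro y hy hy1
    have h3 : Off H (y + 3) := by
      have := (hH.off_add_iff hy1 h2).2
        (by rw [show y + 1 - 2 = y - 1 by ring]; exact hH.not_off_sub_one hy hy1)
      rwa [show y + 1 + 2 = y + 3 by ring] at this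
    refine ⟨h3, ?_⟩
    have := (hH.off_add_one_iff h3).2
      (by rw [show y + 3 - 1 = y + 2 by ring]; exact hH.not_off_add_two hy hy1)
    rwa [show y + 3 + 1 = y + 4 by ring] at this
  have all : ∀ k : ℕ, Off H (x + 3 * k) ∧ Off H (x + 3 * k + 1) := by
    intro k
    induction k with
    | zero => simpa using ⟨hx, hx1⟩
    | succ k ih =>
      have := step _ ih.1 ih.2
      push_cast
      rw [show x + 3 * ((k : F) + 1) = x + 3 * k + 3 by ring,
        show x + 3 * (k : F) + 3 + 1 = x + 3 * k + 4 by ring]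
      exact this
  obtain ⟨p, hp⟩ := CharP.exists F
  have hp0 : (p : F) = 0 := CharP.cast_eq_zero F p
  have hprime : p.Prime := (CharP.char_is_prime_or_zero F p).resolve_right (CharP.char_ne_zero_of_finite F p)
  have h3 : p % 3 = 0 ∨ p % 3 = 1 ∨ p % 3 = 2 := by omega
  rcases h3 with h | h | h
  · have : 3 = p := (Nat.prime_dvd_prime_iff_eq Nat.prime_three hprime).1 (Nat.dvd_of_mod_eq_zero h)
    rw [← this] at hp0
    exact_mod_cast hp0
  · exfalso
    have e : (p : F) = 3 * (p / 3 : ℕ) + 1 := by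
      conv_lhs => rw [← Nat.div_add_mod p 3, h]
      push_cast; ring
    refine hH.not_off_sub_one hx hx1 ?_
    have := (all (p / 3)).1
    rwa [show x + 3 * ((p / 3 : ℕ) : F) = x - 1 by linear_combination hp0 - e] at this
  · exfalso
    have e : (p : F) = 3 * (p / 3 : ℕ) + 2 := by
      conv_lhs => rw [← Nat.div_add_mod p 3, h]
      push_cast; ring
    have a := all (p / 3)
    refine hH.not_off_add_two a.1 a.2 ?_
    rwa [show x + 3 * ((p / 3 : ℕ) : F) + 2 = x by linear_combination hp0 - e]

/-- The dichotomy and multiplicativity fix the cosets of 3, 4, 6, 9 and 12. If 5 were nonzero it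
could lie in neither coset: in `H` it would make 10, 11, 12 three consecutive outside elements, and
outside `H` it would force 6 outside. -/
theorem five_eq_zero_of_off_two [Finite F] (h2 : Off H 2) : (5 : F) = 0 := by
  have h3 : Off H 3 := by
    have := (hH.off_add_one_iff h2).2 (by norm_num; exact fun h => h.2 hH.one)
    norm_num at this
    exact this
  have h4 : H 4 := by
    have := hH.off_mul_off h2 h2
    norm_num at this
    exact this
  have h6 : H 6 := by
    have := hH.off_mul_off h2 h3
    norm_num at this
    exact this
  have h9 : H 9 := by
    have := hH.off_mul_off h3 h3
    norm_num at this
    exact this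
  have h12 : Off H 12 := by
    have := hH.off_mul_mem h3 h4
    norm_num at this
    exact this
  by_contra h50
  rcases mem_or_off h50 with h5 | h5
  · have h10 : Off H 10 := by
      have := hH.off_mul_mem h2 h5
      norm_num at this
      exact this
    have h11 : Off H 11 := by
      have := (hH.off_add_one_iff h10).2 (by norm_num; exact fun h => h.2 h9)
      norm_num at this
      exact this
    have := (hH.off_add_one_iff h11).1 (by norm_num; exact h12)
    norm_num at this
    exact this h10
  · have := (hH.off_add_one_iff h5).2 (by norm_num; exact fun h => h.2 h4)
    norm_num at this
    exact this.2 h6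

-- Let A be the set of first elements of the pairs, so that |F| = 4|A| + 1. In characteristic 5 the
-- translates A, A + 1, ..., A + 4 are disjoint, whence 5|A| ≤ 4|A| + 1.
open Classical in
theorem card_eq_five [Fintype F] (h2 : Off H 2)
    (hcard : Fintype.card F = 2 * (Finset.univ.filter fun x => Off H x).card + 1) :
    Fintype.card F = 5 := by
  have h5 := hH.five_eq_zero_of_off_two h2
  set A := Finset.univ.filter fun x => Off H x ∧ Off H (x + 1) with hA
  have hA2 : 2 * A.card = _ := hH.two_mul_card_off_pair.1
  have key : ∀ x ∈ A, ∀ k : ℕ, k < 5 → x + k ∈ A → k = 0 := by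
    intro x hx k hk hxk
    simp only [hA, Finset.mem_filter, Finset.mem_univ, true_and] at hx hxk
    have n2 := hH.not_off_add_two hx.1 hx.2
    have n4 := hH.not_off_sub_one hx.1 hx.2
    interval_cases k
    · rfl
    · refine absurd ?_ n2
      have := hxk.2
      push_cast at this
      rwa [show x + 1 + 1 = x + 2 by ring] at this
    · exact absurd (by simpa using hxk.1) n2
    · refine absurd ?_ n4
      have := hxk.2
      push_cast at this
      rwa [show x + 3 + 1 = x - 1 by linear_combination h5] at this
    · refine absurd ?_ n4
      have := hxk.1
      push_cast at this
      rwa [show x + 4 = x - 1 by linear_combination h5] at this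
  have hle : (A ×ˢ Finset.range 5).card ≤ Fintype.card F := by
    refine Finset.card_le_card_of_injOn (fun z => z.1 + (z.2 : F)) (by simp) ?_
    rintro ⟨x, i⟩ hx ⟨y, j⟩ hy hxy
    simp only [Finset.coe_product, Set.mem_prod, Finset.mem_coe, Finset.mem_range] at hx hy hxy
    wlog hij : i ≤ j generalizing x y i j
    · exact (this y j x i hxy.symm hy hx (by omega)).symm
    have : j - i = 0 := by
      refine key y hy.1 (j - i) (by omega) ?_
      rw [Nat.cast_sub hij, show y + ((j : F) - i) = x by linear_combination -hxy]
      exact hx.1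
    have hij' : i = j := by omega
    subst hij'
    simpa using hxy
  rw [Finset.card_product, Finset.card_range] at hle
  have hdvd : 5 ≤ Fintype.card F := by
    have : CharP F 5 := (CharP.charP_iff_prime_eq_zero (by norm_num)).2 (by exact_mod_cast h5)
    obtain ⟨n, -, hn⟩ := FiniteField.card F 5
    rw [hn]
    exact Nat.le_self_pow n.ne_zero 5
  omega

/-- In characteristic 3 the hypotheses put all nonzero vectors of the plane spanned by 1 and `h` in
`H`, so the dichotomy applies in each direction of the plane. With signs chosen so that x + u and x
+ w are outside, it forces x + u + w outside, and then neither of x ± (u - w) is outside, a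
contradiction. -/
theorem not_mem_plane [Finite F] (h3 : (3 : F) = 0) {x h : F} (hx : Off H x) (h0 : H h)
    (h1 : H (h + 1)) (h2 : H (h - 1)) : False := by
  obtain ⟨u, hu, hu1, hu2, hxu⟩ : ∃ u, H u ∧ H (h + u) ∧ H (h - u) ∧ Off H (x + u) := by
    by_cases hh : Off H (x + 1)
    · exact ⟨1, hH.one, h1, h2, hh⟩
    · refine ⟨-1, hH.neg_one, by rwa [← sub_eq_add_neg], by rwa [sub_neg_eq_add], ?_⟩
      rw [← sub_eq_add_neg]
      by_contra h'
      exact hh ((hH.off_add_one_iff hx).2 h')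
  obtain ⟨w, hw, hw1, hw2, hxw⟩ : ∃ w, H w ∧ H (u + w) ∧ H (u - w) ∧ Off H (x + w) := by
    by_cases hh : Off H (x + h)
    · exact ⟨h, h0, by rwa [add_comm], by rw [← neg_sub]; exact hH.neg hu2, hh⟩
    · refine ⟨-h, hH.neg h0, ?_, by rwa [sub_neg_eq_add, add_comm], ?_⟩
      · have := hH.neg hu2
        rwa [show u + -h = -(h - u) by ring]
      · rw [← sub_eq_add_neg]
        by_contra h'
        exact hh ((hH.off_add_iff hx h0).2 h')
  have a1 : ¬ Off H (x - (u + w)) := by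
    have := (hH.off_add_iff hxw hw2).1 (by rwa [show x + w + (u - w) = x + u by ring])
    rwa [show x + w - (u - w) = x - (u + w) by linear_combination w * h3] at this
  have a2 : Off H (x + (u + w)) := (hH.off_add_iff hx hw1).2 a1
  have a3 : ¬ Off H (x - (u - w)) := by
    have := (hH.off_add_iff hxw hu).1 (by rwa [show x + w + u = x + (u + w) by ring])
    rwa [show x + w - u = x - (u - w) by ring] at this
  have a4 : ¬ Off H (x + (u - w)) := by
    have := (hH.off_add_iff hxu hw).1 (by rwa [show x + u + w = x + (u + w) by ring])
    rwa [show x + u - w = x + (u - w) by ring] at this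
  exact a4 ((hH.off_add_iff hx hw2).2 a3)

-- The lines a + {0, 1, 2} with a in A, together with the prime field, have at most 3|A| + 3
-- elements, while |F| = 4|A| + 1. Beyond 9 elements some `h` escapes; its line then lies in `H`,
-- contrary to `not_mem_plane`.
open Classical in
theorem card_le_nine [Fintype F] (hne : ∃ x, Off H x) (h3 : (3 : F) = 0)
    (hcard : Fintype.card F = 2 * (Finset.univ.filter fun x => Off H x).card + 1) :
    Fintype.card F ≤ 9 := by
  by_contra! h9
  set A := Finset.univ.filter fun x => Off H x ∧ Off H (x + 1) with hA
  have hA2 : 2 * A.card = _ := hH.two_mul_card_off_pair.1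
  set Z := (A ×ˢ Finset.range 3).image (fun z => z.1 + (z.2 : F)) ∪ {0, 1, -1} with hZ
  have hZc : Z.card ≤ A.card * 3 + 3 := by
    refine (Finset.card_union_le _ _).trans (add_le_add ?_ Finset.card_le_three)
    refine Finset.card_image_le.trans ?_
    simp
  obtain ⟨h, hh⟩ : ∃ h, h ∉ Z := by
    by_contra! hall
    have : Z = Finset.univ := Finset.eq_univ_iff_forall.2 hall
    rw [this, Finset.card_univ] at hZc
    omega
  simp only [hZ, Finset.mem_union, Finset.mem_image, Finset.mem_product, Finset.mem_range,
    Finset.mem_insert, Finset.mem_singleton, not_or, not_exists, not_and, Prod.forall] at hh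
  obtain ⟨hh, n0, n1, n2⟩ := hh
  have hmem : ∀ k : ℕ, k < 3 → ∀ y, y + k = h → ¬ Off H y := by
    intro k hk y hy hoff
    by_cases hy1 : Off H (y + 1)
    · exact hh y k ⟨by simp [hA, hoff, hy1], hk⟩ hy
    · have hy2 : Off H (y - 1) := by
        by_contra h'
        exact hy1 ((hH.off_add_one_iff hoff).2 h')
      have hmA : y - 1 ∈ A := by simp [hA, hoff, hy2]
      have : k = 0 ∨ k = 1 ∨ k = 2 := by omega
      rcases this with rfl | rfl | rfl
      · exact hh (y - 1) 1 ⟨hmA, by omega⟩ (by push_cast at hy ⊢; linear_combination hy)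
      · exact hh (y - 1) 2 ⟨hmA, by omega⟩ (by push_cast at hy ⊢; linear_combination hy)
      · exact hh (y - 1) 0 ⟨hmA, by omega⟩ (by push_cast at hy ⊢; linear_combination hy - h3)
  obtain ⟨x, hx⟩ := hne
  refine hH.not_mem_plane h3 hx (h := h) ?_ ?_ ?_
  · exact (mem_or_off n0).resolve_right (hmem 0 (by omega) _ (by simp))
  · refine (mem_or_off fun h' => n2 ?_).resolve_right (hmem 2 (by omega) _ ?_)
    · linear_combination h'
    · push_cast
      linear_combination h3
  · refine (mem_or_off fun h' => n1 ?_).resolve_right (hmem 1 (by omega) _ ?_)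
    · linear_combination h'
    · push_cast
      ring

open Classical in
theorem card_eq_five_or_nine [Fintype F] (hne : ∃ x, Off H x)
    (hcard : Fintype.card F = 2 * (Finset.univ.filter fun x => Off H x).card + 1) :
    Fintype.card F = 5 ∨ Fintype.card F = 9 := by
  rcases mem_or_off (hH.two_ne_zero' hne) with h2 | h2
  · right
    have h3 := hH.three_eq_zero_of_mem_two hne h2
    have h9 := hH.card_le_nine hne h3 hcard
    have hA2 := hH.two_mul_card_off_pair.1
    have : CharP F 3 := (CharP.charP_iff_prime_eq_zero (by norm_num)).2 (by exact_mod_cast h3)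
    obtain ⟨n, -, hn⟩ := FiniteField.card F 3
    have hn3 : (n : ℕ) < 3 := by
      by_contra! hle
      have := Nat.pow_le_pow_right (show 0 < 3 by norm_num) hle
      omega
    have hn0 := n.pos
    have : (n : ℕ) = 1 ∨ (n : ℕ) = 2 := by omega
    -- Exponent 1 would give |F| = 3 and an outside coset of one element, whereas that coset has
    -- even size.
    rcases this with h | h <;> rw [h] at hn <;> omega
  · left
    exact hH.card_eq_five h2 hcard

end IsAdjacentHalf

/-! ### From matrices to scalars, and finiteness. -/

section Scalar

variable {R : Type*} [CommRing R] [IsDomain R]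

theorem isPotentOf_three_iff {t : R} : IsPotentOf 3 t ↔ t = 0 ∨ t = 1 ∨ t = -1 := by
  unfold IsPotentOf
  constructor
  · intro h
    have : t * ((t - 1) * (t + 1)) = 0 := by linear_combination h
    rcases mul_eq_zero.1 this with h | h
    · exact Or.inl h
    · rcases mul_eq_zero.1 h with h | h
      · exact Or.inr (Or.inl (sub_eq_zero.1 h))
      · exact Or.inr (Or.inr (eq_neg_of_add_eq_zero_left h))
  · rintro (rfl | rfl | rfl) <;> norm_num

theorem isPotentOf_of_mulVec_eq {n : Type*} [Fintype n] [DecidableEq n] {q : ℕ} {c : R}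
    {B : Matrix n n R} (hB : IsPotentOf q B) {v : n → R} (hv : v ≠ 0)
    (h : B.mulVec v = c • v) : IsPotentOf q c := by
  have hpow : ∀ k : ℕ, (B ^ k).mulVec v = c ^ k • v := by
    intro k
    induction k with
    | zero => simp
    | succ k ih => rw [pow_succ, ← Matrix.mulVec_mulVec, h, Matrix.mulVec_smul, ih, smul_smul, pow_succ']
  have := hpow q
  rw [hB, h] at this
  exact (smul_left_injective R hv this).symm

/-- Apply T + 1, T - 1 and T in turn to a nonzero vector: the last nonzero vector reached is an
eigenvector. No extension of scalars is needed. -/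
theorem exists_mulVec_eq_smul_of_isPotentOf_three {n : Type*} [Fintype n] [DecidableEq n]
    [Nonempty n] {T : Matrix n n R} (hT : IsPotentOf 3 T) :
    ∃ t : R, IsPotentOf 3 t ∧ ∃ v : n → R, v ≠ 0 ∧ T.mulVec v = t • v := by
  obtain ⟨v₀, hv₀⟩ := exists_ne (0 : n → R)
  by_cases h1 : (T + 1).mulVec v₀ = 0
  · refine ⟨-1, isPotentOf_three_iff.2 (by simp), v₀, hv₀, ?_⟩
    rw [Matrix.add_mulVec, Matrix.one_mulVec] at h1
    rw [neg_one_smul]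
    exact eq_neg_of_add_eq_zero_left h1
  by_cases h2 : (T - 1).mulVec ((T + 1).mulVec v₀) = 0
  · refine ⟨1, isPotentOf_three_iff.2 (by simp), _, h1, ?_⟩
    rw [Matrix.sub_mulVec, Matrix.one_mulVec] at h2
    rw [one_smul]
    exact sub_eq_zero.1 h2
  · refine ⟨0, isPotentOf_three_iff.2 (by simp), _, h2, ?_⟩
    have : T * ((T - 1) * (T + 1)) = 0 := by
      have hT' : T ^ 3 = T := hT
      calc T * ((T - 1) * (T + 1)) = T ^ 3 - T := by noncomm_ring
        _ = 0 := by rw [hT', sub_self]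
    rw [Matrix.mulVec_mulVec, Matrix.mulVec_mulVec, Matrix.mul_assoc, this]
    simp

theorem exists_mulVec_eq_zero_of_isNilpotent {n : Type*} [Fintype n] [DecidableEq n]
    [Nonempty n] {N : Matrix n n R} (hN : IsNilpotent N) : ∃ v : n → R, v ≠ 0 ∧ N.mulVec v = 0 := by
  by_contra! h
  obtain ⟨v₀, hv₀⟩ := exists_ne (0 : n → R)
  have hpow : ∀ k : ℕ, (N ^ k).mulVec v₀ ≠ 0 := by
    intro k
    induction k with
    | zero => simpa
    | succ k ih =>
      rw [pow_succ', ← Matrix.mulVec_mulVec]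
      exact h _ ih
  obtain ⟨k, hk⟩ := hN
  exact hpow k (by simp [hk])

theorem allTripotentAddPotent_of_matrix {n : Type*} [Fintype n] [DecidableEq n] [Nonempty n]
    {q : ℕ} (h : AllTripotentAddPotent (Matrix n n R) q) : AllTripotentAddPotent R q := by
  intro a
  obtain ⟨T, B, hT, hB, hTB⟩ := h (a • 1)
  obtain ⟨t, ht, v, hv, hTv⟩ := exists_mulVec_eq_smul_of_isPotentOf_three hT
  refine ⟨t, a - t, ht, isPotentOf_of_mulVec_eq hB hv ?_, by ring⟩
  rw [eq_sub_of_add_eq' hTB.symm, Matrix.sub_mulVec, hTv, Matrix.smul_mulVec, Matrix.one_mulVec,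
    sub_smul]

theorem allTripotentAddPotent_of_matrix_nilpotent {n : Type*} [Fintype n] [DecidableEq n]
    [Nonempty n] {q : ℕ} (h : AllNilpotentAddPotent (Matrix n n R) q) :
    AllTripotentAddPotent R q := by
  intro a
  obtain ⟨N, B, hN, hB, hNB⟩ := h (a • 1)
  obtain ⟨v, hv, hNv⟩ := exists_mulVec_eq_zero_of_isNilpotent hN
  refine ⟨0, a, isPotentOf_three_iff.2 (by simp), isPotentOf_of_mulVec_eq hB hv ?_, by ring⟩
  rw [eq_sub_of_add_eq' hNB.symm, Matrix.sub_mulVec, hNv, Matrix.smul_mulVec, Matrix.one_mulVec,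
    sub_zero]

theorem AllIdempotentAddPotent.allTripotentAddPotent {A : Type*} [Ring A] {q : ℕ}
    (h : AllIdempotentAddPotent A q) : AllTripotentAddPotent A q := fun a => by
  obtain ⟨e, b, he, hb, rfl⟩ := h a
  exact ⟨e, b, he.pow_eq (by norm_num), hb, rfl⟩

theorem AllIdempotentAddPotent.allPotentAddOrSubIdempotent {A : Type*} [Ring A] {q : ℕ}
    (h : AllIdempotentAddPotent A q) : AllPotentAddOrSubIdempotent A q := fun a => by
  obtain ⟨e, b, he, hb, rfl⟩ := h a
  exact ⟨b, e, hb, he, Or.inl (add_comm e b)⟩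

theorem AllPotentAddOrSubIdempotent.allTripotentAddPotent {A : Type*} [Ring A] {q : ℕ}
    (h : AllPotentAddOrSubIdempotent A q) : AllTripotentAddPotent A q := fun a => by
  obtain ⟨b, e, hb, he, rfl | rfl⟩ := h a
  · exact ⟨e, b, he.pow_eq (by norm_num), hb, add_comm b e⟩
  · refine ⟨-e, b, ?_, hb, sub_eq_neg_add b e⟩
    rw [IsPotentOf, Odd.neg_pow (by decide), he.pow_eq (by norm_num)]

/-- Tripotents and `q`-potents are roots of nonzero polynomials over the fraction field, so `R` is a
sum of two finite sets. -/
theorem finite_of_allTripotentAddPotent {q : ℕ} (hq : 1 < q) (h : AllTripotentAddPotent R q) :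
    Finite R := by
  have hfin : ∀ k : ℕ, 1 < k → {x : R | IsPotentOf k x}.Finite := by
    intro k hk
    have hne := FiniteField.X_pow_card_sub_X_ne_zero (FractionRing R) hk
    refine Set.Finite.of_finite_image (f := algebraMap R (FractionRing R)) ?_
      (IsFractionRing.injective R (FractionRing R)).injOn
    refine (Polynomial.finite_setOfPred_isRoot hne).subset ?_
    rintro _ ⟨x, hx, rfl⟩
    have hx' : x ^ k = x := hx
    simp [← map_pow, hx']
  have : (Set.univ : Set R) ⊆
      Set.image2 (fun x y => x + y) {x : R | IsPotentOf 3 x} {x : R | IsPotentOf q x} := by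
    rintro a -
    obtain ⟨t, b, ht, hb, rfl⟩ := h a
    exact Set.mem_image2_of_mem ht hb
  exact Set.finite_univ_iff.1 (((hfin 3 (by norm_num)).image2 _ (hfin q hq)).subset this)

end Scalar

/-! ### Index of the group of nonzero `q`-potents. -/

section Field

variable {F : Type*} [Field F]

theorem isPotentOf_iff_pow_sub_one {q : ℕ} (hq : 1 < q) {x : F} (hx : x ≠ 0) :
    IsPotentOf q x ↔ x ^ (q - 1) = 1 := by
  rw [IsPotentOf, ← Nat.sub_add_cancel hq.le, pow_succ, Nat.add_sub_cancel]
  exact mul_eq_right₀ hx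

open Classical in
theorem card_sub_one_dvd_or_card_eq [Fintype F] {q : ℕ} (hq : 1 < q) (hodd : Odd q)
    (h : AllTripotentAddPotent F q) :
    (Fintype.card F - 1) ∣ (q - 1) ∨ Fintype.card F = 5 ∨ Fintype.card F = 9 := by
  set G : Subgroup Fˣ := (powMonoidHom (q - 1)).ker with hG
  have hGmem : ∀ u : Fˣ, u ∈ G ↔ u ^ (q - 1) = 1 := fun u => MonoidHom.mem_ker
  set H : F → Prop := fun x => x ≠ 0 ∧ x ^ (q - 1) = 1 with hHdef
  have hHG : ∀ u : Fˣ, H u ↔ u ∈ G := by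
    intro u
    rw [hGmem, hHdef, Units.ext_iff]
    simp
  have hneg : H (-1) := ⟨by simp, (Nat.Odd.sub_odd hodd odd_one).neg_one_pow⟩
  have hmul : ∀ {x y}, H x → H y → H (x * y) := fun hx hy =>
    ⟨mul_ne_zero hx.1 hy.1, by rw [mul_pow, hx.2, hy.2, one_mul]⟩
  have hone : H 1 := by simp [hHdef]
  have hadj : ∀ {x}, x ≠ 0 → ¬ H x → H (x + 1) ∨ H (x - 1) := by
    intro x hx0 hx
    obtain ⟨t, b, ht, hb, rfl⟩ := h x
    have hb0 : b ≠ 0 := by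
      rintro rfl
      rcases isPotentOf_three_iff.1 ht with rfl | rfl | rfl
      · simp at hx0
      · exact hx (by simpa using hone)
      · exact hx (by simpa using hneg)
    have hb1 : H b := ⟨hb0, (isPotentOf_iff_pow_sub_one hq hb0).1 hb⟩
    rcases isPotentOf_three_iff.1 ht with rfl | rfl | rfl
    · exact absurd (by simpa using hb1) hx
    · right; simpa using hb1
    · left; simpa using hb1
  set C := Finset.univ.filter fun x => IsAdjacentHalf.Off H x with hC
  set P := Finset.univ.filter fun x => H x with hP
  have hcard : C.card + P.card + 1 = Fintype.card F := by
    have h1 : Finset.univ = insert 0 (C ∪ P) := by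
      ext x
      simp only [hC, hP, Finset.mem_univ, Finset.mem_insert, Finset.mem_union,
        Finset.mem_filter, true_and, true_iff]
      by_cases hx : x = 0
      · exact Or.inl hx
      · exact Or.inr (IsAdjacentHalf.mem_or_off hx).symm
    rw [← Finset.card_univ, h1, Finset.card_insert_of_notMem, Finset.card_union_of_disjoint]
    · rw [Finset.disjoint_filter]
      exact fun x _ hx => hx.2
    · simp [hC, hP, IsAdjacentHalf.Off, hHdef]
  -- Each outside x is y - 1 or y + 1 with y in `H`. The values y = 1 and y = -1 respectively drop
  -- out because they give x = 0; this saving makes the index strictly less than 3.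
  have hle : C.card ≤ 2 * (P.card - 1) := by
    have hsub : C ⊆ (P.erase 1).image (fun y => y - 1) ∪ (P.erase (-1)).image (fun y => y + 1) := by
      intro x hx
      simp only [hC, Finset.mem_filter, Finset.mem_univ, true_and] at hx
      simp only [hP, Finset.mem_union, Finset.mem_image, Finset.mem_erase, Finset.mem_filter,
        Finset.mem_univ, true_and]
      rcases hadj hx.1 hx.2 with h1 | h1
      · exact Or.inl ⟨x + 1, ⟨by simpa using hx.1, h1⟩, by ring⟩
      · exact Or.inr ⟨x - 1, ⟨fun h' => hx.1 (by linear_combination h'), h1⟩, by ring⟩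
    have e1 : (P.erase 1).card = P.card - 1 := Finset.card_erase_of_mem (by simp [hP, hone])
    have e2 : (P.erase (-1)).card = P.card - 1 := Finset.card_erase_of_mem (by simp [hP, hneg])
    calc C.card ≤ _ := Finset.card_le_card hsub
      _ ≤ _ := Finset.card_union_le _ _
      _ ≤ (P.card - 1) + (P.card - 1) := add_le_add (e1 ▸ Finset.card_image_le)
        (e2 ▸ Finset.card_image_le)
      _ = _ := by ring
  have hPpos : 0 < P.card := Finset.card_pos.2 ⟨1, by simp [hP, hone]⟩
  have hPG : P.card = Nat.card G := by
    rw [Nat.card_eq_fintype_card, ← Finset.card_univ]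
    refine Finset.card_bij' (fun x hx => ⟨Units.mk0 x (Finset.mem_filter.1 hx).2.1, ?_⟩)
      (fun u _ => ((u : Fˣ) : F)) ?_ ?_ ?_ ?_
    · exact (hHG _).1 (Finset.mem_filter.1 hx).2
    · simp
    · exact fun u _ => Finset.mem_filter.2 ⟨Finset.mem_univ _, (hHG _).2 u.2⟩
    · simp
    · simp
  have hindex : P.card * G.index = Fintype.card F - 1 := by
    rw [hPG, G.card_mul_index, Nat.card_eq_fintype_card, Fintype.card_units]
  have hlt : G.index < 3 := by
    by_contra! h3
    have := Nat.mul_le_mul_left P.card h3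
    omega
  have hpos : G.index ≠ 0 := Subgroup.index_ne_zero_of_finite
  have : G.index = 1 ∨ G.index = 2 := by omega
  rcases this with h1 | h2
  · left
    rw [← FiniteField.forall_pow_eq_one_iff]
    intro u
    rw [← hGmem, Subgroup.index_eq_one.1 h1]
    trivial
  · right
    have hinv : ∀ {x}, H x → H x⁻¹ := fun hx => ⟨inv_ne_zero hx.1, by rw [inv_pow, hx.2, inv_one]⟩
    have hH : IsAdjacentHalf H := by
      refine ⟨fun h => h.1 rfl, hneg, hmul, hinv, ?_, hadj⟩
      intro x y hx hy hHx hHy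
      have := hHG (Units.mk0 x hx * Units.mk0 y hy)
      rw [Subgroup.mul_mem_iff_of_index_two h2, ← hHG, ← hHG] at this
      simpa [hHx, hHy] using this
    have hCP : Fintype.card F = 2 * C.card + 1 := by
      rw [h2] at hindex
      omega
    refine hH.card_eq_five_or_nine ?_ hCP
    have : 0 < C.card := by omega
    obtain ⟨x, hx⟩ := Finset.card_pos.1 this
    exact ⟨x, by simpa [hC] using hx⟩

end Field

theorem isField_and_card_dvd_of_allTripotentAddPotent {R : Type*} [CommRing R] [IsDomain R]
    {q : ℕ} (hq : 1 < q) (hodd : Odd q) (h5 : IsEmpty (R ≃+* ZMod 5))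
    (h9 : IsEmpty (R ≃+* GaloisField 3 2)) (h : AllTripotentAddPotent R q) :
    Finite R ∧ IsField R ∧ (Nat.card R - 1) ∣ (q - 1) := by
  have hfin := finite_of_allTripotentAddPotent hq h
  have hfield := Finite.isField_of_domain R
  refine ⟨hfin, hfield, ?_⟩
  let _ := hfield.toField
  have := Fintype.ofFinite R
  have := Fintype.ofFinite (GaloisField 3 2)
  have : Fact (Nat.Prime 5) := ⟨by norm_num⟩
  rw [Nat.card_eq_fintype_card]
  rcases card_sub_one_dvd_or_card_eq hq hodd h with h | h | h
  · exact h
  · exact (h5.false (FiniteField.ringEquivOfCardEq (h.trans (ZMod.card 5).symm))).elim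
  · refine (h9.false (FiniteField.ringEquivOfCardEq ?_)).elim
    rw [h, ← Nat.card_eq_fintype_card, GaloisField.card 3 2 (by norm_num)]
    norm_num

/-! ### Splitting cyclic modules along a Newton basis. -/

section Chain

open Polynomial

variable {F : Type*} [Field F]

theorem LinearMap.map_aeval_of_comp_eq {V W : Type*} [AddCommGroup V] [Module F V]
    [AddCommGroup W] [Module F W] {φ : V →ₗ[F] W} {f : Module.End F V} {g : Module.End F W}
    (h : φ ∘ₗ f = g ∘ₗ φ) (P : F[X]) (v : V) : φ (aeval f P v) = aeval g P (φ v) := by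
  induction P using Polynomial.induction_on' generalizing v with
  | add P Q hP hQ => simp [hP, hQ]
  | monomial n a =>
    have hpow : ∀ (n : ℕ) (v : V), φ ((f ^ n) v) = (g ^ n) (φ v) := by
      intro n
      induction n with
      | zero => simp
      | succ n ih =>
        intro v
        rw [pow_succ, pow_succ, Module.End.mul_apply, Module.End.mul_apply, ih]
        congr 1
        exact LinearMap.congr_fun h v
    simp [aeval_monomial, hpow]

/-- Multiplication by `X` on the `F[X]`-module `W` is the sum of an `F`-linear map killed by `P`
and one killed by `r`. -/
def HasSplit (P r : F[X]) (W : Type*) [AddCommGroup W] [Module F W] [Module F[X] W] : Prop :=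
  ∃ N D : Module.End F W, aeval N P = 0 ∧ aeval D r = 0 ∧ ∀ w, (X : F[X]) • w = N w + D w

namespace HasSplit

variable {P r : F[X]}

theorem congr {V W : Type*} [AddCommGroup V] [Module F V] [Module F[X] V]
    [AddCommGroup W] [Module F W] [Module F[X] W] [IsScalarTower F F[X] V]
    [IsScalarTower F F[X] W] (e : V ≃ₗ[F[X]] W) (h : HasSplit P r V) : HasSplit P r W := by
  obtain ⟨N, D, hN, hD, hX⟩ := h
  let e' : V ≃ₗ[F] W := e.restrictScalars F
  have key : ∀ (f : Module.End F V) (Q : F[X]), aeval f Q = 0 →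
      aeval (e'.toLinearMap ∘ₗ f ∘ₗ e'.symm.toLinearMap) Q = 0 := by
    intro f Q hQ
    ext w
    obtain ⟨v, rfl⟩ := e'.surjective w
    have := LinearMap.map_aeval_of_comp_eq (φ := e'.toLinearMap) (f := f)
      (g := e'.toLinearMap ∘ₗ f ∘ₗ e'.symm.toLinearMap) (by ext; simp) Q v
    rw [hQ] at this
    simpa using this.symm
  refine ⟨_, _, key N P hN, key D r hD, fun w => ?_⟩
  obtain ⟨v, rfl⟩ := e'.surjective w
  have : (X : F[X]) • e' v = e' ((X : F[X]) • v) := (e.map_smul X v).symm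
  rw [this, hX]
  simp

theorem pi {ι : Type*} {V : ι → Type*} [∀ i, AddCommGroup (V i)]
    [∀ i, Module F (V i)] [∀ i, Module F[X] (V i)] (h : ∀ i, HasSplit P r (V i)) :
    HasSplit P r (∀ i, V i) := by
  choose N D hN hD hX using h
  have key : ∀ (f : ∀ i, Module.End F (V i)) (Q : F[X]), (∀ i, aeval (f i) Q = 0) →
      aeval (LinearMap.piMap f : Module.End F (∀ i, V i)) Q = 0 := by
    intro f Q hQ
    refine LinearMap.ext fun w => funext fun i => ?_
    have := LinearMap.map_aeval_of_comp_eq (φ := LinearMap.proj i)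
      (f := (LinearMap.piMap f : Module.End F (∀ i, V i))) (g := f i) (by ext; simp) Q w
    rw [hQ] at this
    simpa using this
  exact ⟨_, _, key N P hN, key D r hD, fun w => funext fun i => hX i (w i)⟩

theorem of_subsingleton {V : Type*} [AddCommGroup V] [Module F V] [Module F[X] V]
    [Subsingleton V] : HasSplit P r V :=
  ⟨0, 0, Subsingleton.elim _ _, Subsingleton.elim _ _, fun _ => Subsingleton.elim _ _⟩

end HasSplit

/-- The Newton polynomials `∏ j < i, (X - g j)`. -/
noncomputable def newtonSequence (g : ℕ → F) : Polynomial.Sequence F where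
  elems' i := ∏ j ∈ Finset.range i, (X - C (g j))
  degree_eq' i := by simp [degree_prod]

theorem newtonSequence_succ (g : ℕ → F) (i : ℕ) :
    newtonSequence g (i + 1) = newtonSequence g i * (X - C (g i)) :=
  Finset.prod_range_succ _ _

theorem newtonSequence_monic (g : ℕ → F) (i : ℕ) : (newtonSequence g i).Monic :=
  monic_prod_of_monic (Finset.range i) (fun j => X - C (g j)) fun j _ => monic_X_sub_C (g j)

/-- The images of the Newton polynomials form a basis on which X is bidiagonal. The trace condition
makes the Newton polynomial of degree m + 1 agree with `p` in its two top coefficients, so modulo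
`p` it has degree less than m: the last column has diagonal entry exactly `g m`. -/
theorem exists_newton_chain {p : F[X]} (hp : p.Monic) {m : ℕ} (hdeg : p.natDegree = m + 1)
    {g : ℕ → F} (hg : ∑ i ∈ Finset.range (m + 1), g i = -p.nextCoeff) :
    ∃ (β : ℕ → F[X] ⧸ Ideal.span {p}) (b : Module.Basis (Fin (m + 1)) F (F[X] ⧸ Ideal.span {p})),
      (∀ i, b i = β i) ∧ (∀ i, (X : F[X]) • β i = g i • β i + β (i + 1)) ∧
      β (m + 1) ∈ Submodule.span F (β '' Set.Iio m) := by
  let π : F[X] →ₗ[F] F[X] ⧸ Ideal.span {p} := (Ideal.Quotient.mkₐ F (Ideal.span {p})).toLinearMap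
  have hπp : ∀ f, π (p * f) = 0 := fun f =>
    Ideal.Quotient.eq_zero_iff_mem.2 (Ideal.mul_mem_right _ _ (Ideal.mem_span_singleton_self p))
  set S := newtonSequence g with hS
  let β : ℕ → F[X] ⧸ Ideal.span {p} := fun i => π (S i)
  have hspan : ∀ (k : ℕ) (f : F[X]), f.degree < k → π f ∈ Submodule.span F (β '' Set.Iio k) := by
    intro k f hf
    have h1 : f ∈ Submodule.span F (S '' Set.Iio k) := by
      rw [S.span_degreeLT fun i _ => by rw [newtonSequence_monic g i]; exact isUnit_one]
      exact mem_degreeLT.2 hf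
    have h2 := Submodule.mem_map_of_mem (f := π) h1
    rwa [Submodule.map_span, ← Set.image_comp] at h2
  have htop : ⊤ ≤ Submodule.span F (Set.range fun i : Fin (m + 1) => β i) := by
    rintro w -
    obtain ⟨f, rfl⟩ := Ideal.Quotient.mk_surjective w
    have h1 : π f = π (f %ₘ p) := by
      conv_lhs => rw [← modByMonic_add_div f p, map_add, hπp, add_zero]
    have h2 : (f %ₘ p).degree < (m + 1 : ℕ) := by
      rw [← hdeg, ← degree_eq_natDegree hp.ne_zero]
      exact degree_modByMonic_lt f hp
    change π f ∈ _
    rw [h1]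
    refine Submodule.span_mono ?_ (hspan _ _ h2)
    rintro _ ⟨i, hi, rfl⟩
    exact ⟨⟨i, hi⟩, rfl⟩
  have hfr : Fintype.card (Fin (m + 1)) = Module.finrank F (F[X] ⧸ Ideal.span {p}) := by
    rw [finrank_quotient_span_eq_natDegree, hdeg, Fintype.card_fin]
  refine ⟨β, Module.Basis.mk (linearIndependent_of_top_le_span_of_card_eq_finrank htop hfr) htop,
    fun i => by simp, fun i => ?_, ?_⟩
  · have h1 : X * S i = g i • S i + S (i + 1) := by
      rw [hS, newtonSequence_succ, smul_eq_C_mul]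
      ring
    have h2 : (X : F[X]) • β i = π (X * S i) := rfl
    rw [h2, h1, map_add, map_smul]
  · have h1 : β (m + 1) = π (S (m + 1) - p) := by
      have h2 := hπp 1
      rw [mul_one] at h2
      rw [map_sub, h2, sub_zero]
    rw [h1]
    refine hspan _ _ ((degree_lt_iff_coeff_zero _ _).2 fun k hk => ?_)
    have hm := newtonSequence_monic g (m + 1)
    have hd : (newtonSequence g (m + 1)).natDegree = m + 1 := Sequence.natDegree_eq _ _
    rw [coeff_sub, sub_eq_zero]
    rcases (show k = m ∨ k = m + 1 ∨ m + 1 < k by omega) with rfl | rfl | hk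
    · have e1 : (newtonSequence g (k + 1)).nextCoeff = p.nextCoeff := by
        rw [← neg_neg p.nextCoeff, ← hg]
        exact prod_X_sub_C_nextCoeff (s := Finset.range (k + 1)) g
      rw [nextCoeff_of_natDegree_pos (by omega), nextCoeff_of_natDegree_pos (by omega), hd,
        hdeg] at e1
      exact e1
    · have e1 := hm.coeff_natDegree
      have e2 := hp.coeff_natDegree
      rw [hd] at e1
      rw [hdeg] at e2
      rw [hS, e1, e2]
    · rw [coeff_eq_zero_of_natDegree_lt (hd.trans_lt hk),
        coeff_eq_zero_of_natDegree_lt (hdeg.trans_lt hk)]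

/-- On the span of the first m vectors, `D` consists of blocks of size 1, and of size 2 with
distinct eigenvalues, so the squarefree product over `S` kills it. The factor X - d m sends the last
vector into that span, whatever the rest of its column is. -/
theorem aeval_prod_mul_eq_zero_of_chain {V : Type*} [AddCommGroup V] [Module F V]
    {D : Module.End F V} {β : ℕ → V} {d : ℕ → F} {ν : ℕ → Prop} [DecidablePred ν] {S : Finset F}
    {m : ℕ} (hD : ∀ i < m, D (β i) = d i • β i + if ν i then 0 else β (i + 1))
    (hm : D (β m) - d m • β m ∈ Submodule.span F (β '' Set.Iio m))
    (htop : Submodule.span F (β '' Set.Iic m) = ⊤) (hS : ∀ i < m, d i ∈ S)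
    (hν : ∀ i < m, ¬ ν i → i + 1 < m ∧ ν (i + 1) ∧ d i ≠ d (i + 1)) :
    aeval D ((∏ a ∈ S, (X - C a)) * (X - C (d m))) = 0 := by
  classical
  set f := ∏ a ∈ S, (X - C a) with hf
  have hlin : ∀ (a : F) (v : V), aeval D (X - C a) v = D v - a • v := by
    intro a v
    simp [Algebra.algebraMap_eq_smul_one]
  have hker : ∀ Q : F[X], Q ∣ f → ∀ v, aeval D Q v = 0 → aeval D f v = 0 := by
    rintro Q ⟨g, hg⟩ v hv
    rw [hg, mul_comm, map_mul, Module.End.mul_apply, hv, map_zero]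
  have h1 : ∀ i < m, aeval D f (β i) = 0 := by
    intro i hi
    by_cases hi' : ν i
    · refine hker _ (Finset.dvd_prod_of_mem _ (hS i hi)) _ ?_
      rw [hlin, hD i hi, if_pos hi']
      simp
    · obtain ⟨hi1, hi2, hne⟩ := hν i hi hi'
      have hdvd : (X - C (d (i + 1))) * (X - C (d i)) ∣ f := by
        rw [hf, ← Finset.mul_prod_erase S _ (hS (i + 1) hi1)]
        exact mul_dvd_mul_left _
          (Finset.dvd_prod_of_mem (fun a => X - C a) (Finset.mem_erase.2 ⟨hne, hS i hi⟩))
      refine hker _ hdvd _ ?_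
      rw [map_mul, Module.End.mul_apply, hlin (d i), hD i hi, if_neg hi', add_sub_cancel_left, hlin,
        hD (i + 1) hi1, if_pos hi2]
      simp
  have h2 : Submodule.span F (β '' Set.Iio m) ≤ LinearMap.ker (aeval D f) := by
    rw [Submodule.span_le]
    rintro _ ⟨i, hi, rfl⟩
    exact h1 i hi
  have h3 : (⊤ : Submodule F V) ≤ LinearMap.ker (aeval D (f * (X - C (d m)))) := by
    rw [← htop, Submodule.span_le]
    rintro _ ⟨i, hi, rfl⟩
    rw [SetLike.mem_coe, LinearMap.mem_ker]
    rcases (Set.mem_Iic.1 hi).lt_or_eq with h | rfl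
    · rw [mul_comm, map_mul, Module.End.mul_apply, h1 i h, map_zero]
    · rw [map_mul, Module.End.mul_apply, hlin]
      exact h2 hm
  ext v
  exact h3 (Submodule.mem_top : v ∈ ⊤)

/-- N takes the diagonal `ε` and the subdiagonal entries selected by `ν`; D takes the diagonal `d`,
the other subdiagonal entries and the rest of the last column. -/
theorem hasSplit_of_diagonal {p : F[X]} (hp : p.Monic) {m : ℕ} (hdeg : p.natDegree = m + 1)
    {P r : F[X]} {d ε : ℕ → F} {ν : ℕ → Prop} [DecidablePred ν] {S : Finset F}
    (hsum : ∑ i ∈ Finset.range (m + 1), (d i + ε i) = -p.nextCoeff) (hS : ∀ i < m, d i ∈ S)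
    (hν : ∀ i < m, ¬ ν i → i + 1 < m ∧ ν (i + 1) ∧ d i ≠ d (i + 1))
    (hr : (∏ a ∈ S, (X - C a)) * (X - C (d m)) ∣ r)
    (hP : ∀ (N : Module.End F (F[X] ⧸ Ideal.span {p})) (β : ℕ → F[X] ⧸ Ideal.span {p}),
      Submodule.span F (β '' Set.Iic m) = ⊤ →
      (∀ i < m, N (β i) = ε i • β i + if ν i then β (i + 1) else 0) →
      N (β m) = ε m • β m → aeval N P = 0) :
    HasSplit P r (F[X] ⧸ Ideal.span {p}) := by
  obtain ⟨β, b, hb, hX, hβ⟩ := exists_newton_chain hp hdeg hsum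
  let μ : Module.End F (F[X] ⧸ Ideal.span {p}) := Module.toModuleEnd F (S := F[X]) _ X
  have hμ : ∀ w, μ w = (X : F[X]) • w := fun w => rfl
  have htop : Submodule.span F (β '' Set.Iic m) = ⊤ := by
    rw [← b.span_eq]
    congr 1
    ext w
    constructor
    · rintro ⟨i, hi, rfl⟩
      exact ⟨⟨i, Nat.lt_succ_of_le hi⟩, hb _⟩
    · rintro ⟨i, rfl⟩
      exact ⟨i, Nat.le_of_lt_succ i.2, (hb i).symm⟩
  let N : Module.End F (F[X] ⧸ Ideal.span {p}) :=
    b.constr F fun i => ε i • β i + if (i : ℕ) < m ∧ ν i then β (i + 1) else 0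
  have hN : ∀ i ≤ m, N (β i) = ε i • β i + if i < m ∧ ν i then β (i + 1) else 0 := by
    intro i hi
    have := b.constr_basis F (fun i => ε i • β i + if (i : ℕ) < m ∧ ν i then β (i + 1) else 0)
      ⟨i, Nat.lt_succ_of_le hi⟩
    rwa [hb] at this
  have hNlt : ∀ i < m, N (β i) = ε i • β i + if ν i then β (i + 1) else 0 := by
    intro i hi
    simp [hN i hi.le, hi]
  have hNm : N (β m) = ε m • β m := by simp [hN m le_rfl]
  refine ⟨N, μ - N, hP N β htop hNlt hNm, ?_, fun w => by simp [hμ]⟩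
  obtain ⟨c, hc⟩ := hr
  rw [hc, map_mul, aeval_prod_mul_eq_zero_of_chain (β := β) (ν := ν) ?_ ?_ htop hS hν, zero_mul]
  · intro i hi
    rw [LinearMap.sub_apply, hμ, hX, hNlt i hi]
    split_ifs <;> module
  · rw [LinearMap.sub_apply, hμ, hX, hNm]
    convert hβ using 1
    module

/-- N is a direct sum of scalars 0 or 1 and of blocks sending β i and β (i + 1) both to β (i + 1).
-/
theorem aeval_sq_sub_self_eq_zero_of_chain {V : Type*} [AddCommGroup V] [Module F V]
    {N : Module.End F V} {β : ℕ → V} {ε : ℕ → F} {ν : ℕ → Prop} [DecidablePred ν] {m : ℕ}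
    (htop : Submodule.span F (β '' Set.Iic m) = ⊤)
    (hN : ∀ i < m, N (β i) = ε i • β i + if ν i then β (i + 1) else 0)
    (hm : N (β m) = ε m • β m) (hε : ∀ i ≤ m, ε i = 0 ∨ ε i = 1)
    (hν : ∀ i < m, ν i → ε i = 0 ∧ ¬ ν (i + 1) ∧ ε (i + 1) = 1) :
    aeval N (X ^ 2 - X : F[X]) = 0 := by
  have h1 : ∀ i ≤ m, (i < m → ¬ ν i) → N (β i) = ε i • β i := by
    intro i hi h
    rcases hi.lt_or_eq with h' | rfl
    · simp [hN i h', h h']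
    · exact hm
  have h2 : ∀ i ≤ m, N (N (β i)) = N (β i) := by
    intro i hi
    by_cases hi' : i < m ∧ ν i
    · obtain ⟨e1, e2, e3⟩ := hν i hi'.1 hi'.2
      have : N (β i) = β (i + 1) := by simp [hN i hi'.1, hi'.2, e1]
      rw [this, h1 (i + 1) hi'.1 fun _ => e2, e3, one_smul]
    · rw [h1 i hi fun h h' => hi' ⟨h, h'⟩]
      rcases hε i hi with h | h <;> simp [h, h1 i hi fun h h' => hi' ⟨h, h'⟩]
  have h3 : (⊤ : Submodule F V) ≤ LinearMap.ker (aeval N (X ^ 2 - X : F[X])) := by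
    rw [← htop, Submodule.span_le]
    rintro _ ⟨i, hi, rfl⟩
    simp [pow_two, h2 i hi]
  ext v
  exact h3 (Submodule.mem_top : v ∈ ⊤)

theorem pow_eq_zero_of_chain {V : Type*} [AddCommGroup V] [Module F V]
    {N : Module.End F V} {β : ℕ → V} {m : ℕ} (htop : Submodule.span F (β '' Set.Iic m) = ⊤)
    (hN : ∀ i < m, N (β i) = β (i + 1)) (hm : N (β m) = 0) : N ^ (m + 1) = 0 := by
  have h1 : ∀ k i, i ≤ m → m < i + k → (N ^ k) (β i) = 0 := by
    intro k
    induction k with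
    | zero => intro i h h'; omega
    | succ k ih =>
      intro i h h'
      rw [pow_succ, Module.End.mul_apply]
      rcases h.lt_or_eq with h2 | rfl
      · rw [hN i h2]
        exact ih _ h2 (by omega)
      · rw [hm, map_zero]
  have h3 : (⊤ : Submodule F V) ≤ LinearMap.ker (N ^ (m + 1)) := by
    rw [← htop, Submodule.span_le]
    rintro _ ⟨i, hi, rfl⟩
    exact h1 _ _ hi (by omega)
  ext v
  exact h3 (Submodule.mem_top : v ∈ ⊤)

theorem hasSplit_quotient_of_ne_zero {P r : F[X]} {k : ℕ}
    (h : ∀ p : F[X], p.Monic → 0 < p.natDegree → p.natDegree ≤ k →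
      HasSplit P r (F[X] ⧸ Ideal.span {p})) {p : F[X]} (hp : p ≠ 0) (hk : p.natDegree ≤ k) :
    HasSplit P r (F[X] ⧸ Ideal.span {p}) := by
  have hunit : IsUnit (C p.leadingCoeff⁻¹) :=
    isUnit_C.2 (inv_ne_zero (leadingCoeff_ne_zero.2 hp)).isUnit
  have hmonic : (p * C p.leadingCoeff⁻¹).Monic := monic_mul_leadingCoeff_inv hp
  have hspan : Ideal.span {p * C p.leadingCoeff⁻¹} = Ideal.span {p} :=
    Ideal.span_singleton_mul_right_unit hunit p
  have hdeg : (p * C p.leadingCoeff⁻¹).natDegree = p.natDegree :=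
    natDegree_mul_leadingCoeff_inv p hp
  refine HasSplit.congr (Submodule.quotEquivOfEq _ _ hspan) ?_
  rcases Nat.eq_zero_or_pos (p * C p.leadingCoeff⁻¹).natDegree with h0 | h0
  · have : Subsingleton (F[X] ⧸ Ideal.span {p * C p.leadingCoeff⁻¹}) := by
      rw [Ideal.Quotient.subsingleton_iff, hmonic.natDegree_eq_zero.1 h0,
        Ideal.span_singleton_one]
    exact HasSplit.of_subsingleton
  · exact h _ hmonic h0 (hdeg.trans_le hk)

/-- Structure theorem for the torsion F[X]-module defined by `A`. The bound on the degrees of the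
blocks supplies a common nilpotency exponent. -/
theorem exists_split_of_hasSplit {n : Type*} [Fintype n] [DecidableEq n] {P r : F[X]}
    (h : ∀ p : F[X], p.Monic → 0 < p.natDegree → p.natDegree ≤ Fintype.card n →
      HasSplit P r (F[X] ⧸ Ideal.span {p})) (A : Matrix n n F) :
    ∃ N D : Matrix n n F, aeval N P = 0 ∧ aeval D r = 0 ∧ A = N + D := by
  let V := Module.AEval' (Matrix.toLin' A)
  have htors : Module.IsTorsion F[X] V := Module.AEval.isTorsion_of_finiteDimensional F (n → F) _
  obtain ⟨ι, _, p, hp, e, ⟨l⟩⟩ := Module.equiv_directSum_of_isTorsion htors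
  classical
  let l' : V ≃ₗ[F[X]] ∀ i, F[X] ⧸ Ideal.span {p i ^ e i} :=
    l.trans (DirectSum.linearEquivFunOnFintype F[X] ι fun i => F[X] ⧸ Ideal.span {p i ^ e i})
  have hle : ∀ i, (p i ^ e i).natDegree ≤ Fintype.card n := by
    intro i
    have h1 := LinearMap.finrank_le_finrank_of_injective
      (f := (l'.restrictScalars F).symm.toLinearMap ∘ₗ
        LinearMap.single F (fun i => F[X] ⧸ Ideal.span {p i ^ e i}) i)
      ((l'.restrictScalars F).symm.injective.comp
        (Pi.single_injective (M := fun i => F[X] ⧸ Ideal.span {p i ^ e i}) i))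
    have h2 : Module.finrank F V = Fintype.card n := by
      rw [← (Module.AEval'.of (Matrix.toLin' A)).finrank_eq, Module.finrank_fintype_fun_eq_card]
    rwa [finrank_quotient_span_eq_natDegree, h2] at h1
  have hV : HasSplit P r V := HasSplit.congr l'.symm
    (HasSplit.pi fun i => hasSplit_quotient_of_ne_zero h (pow_ne_zero _ (hp i).ne_zero) (hle i))
  obtain ⟨N, D, hN, hD, hX⟩ := hV
  let o : (n → F) ≃ₗ[F] V := Module.AEval'.of (Matrix.toLin' A)
  let T : Module.End F V ≃ₐ[F] Matrix n n F :=
    (o.symm.conjAlgEquiv F).trans LinearMap.toMatrixAlgEquiv'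
  refine ⟨T N, T D, ?_, ?_, ?_⟩
  · rw [aeval_algHom_apply, hN, map_zero]
  · rw [aeval_algHom_apply, hD, map_zero]
  · have hlin : o.symm.conjAlgEquiv F (N + D) = Matrix.toLin' A := by
      refine LinearMap.ext fun w => ?_
      have h1 : N (o w) + D (o w) = o (Matrix.toLin' A w) :=
        (hX (o w)).symm.trans (Module.AEval'.X_smul_of _ w)
      exact (congrArg o.symm h1).trans (o.symm_apply_apply _)
    rw [← map_add, AlgEquiv.trans_apply, hlin]
    exact (LinearMap.toMatrix'_toLin' A).symm

end Chain

/-! ### Choosing diagonals with prescribed trace. -/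

section Diagonal

open Polynomial

variable {F : Type*} [Field F]

theorem exists_notMem_of_card_lt {α : Type*} [Fintype α] {S : Finset α}
    (h : S.card < Fintype.card α) : ∃ x, x ∉ S := by
  by_contra! hall
  rw [Finset.eq_univ_iff_forall.2 hall, Finset.card_univ] at h
  exact h.false

theorem prod_X_sub_C_dvd_of_isRoot {S : Finset F} {f : F[X]} (h : ∀ a ∈ S, f.IsRoot a) :
    ∏ a ∈ S, (X - C a) ∣ f :=
  Finset.prod_dvd_of_coprime
    (fun _ _ _ _ hab => pairwise_coprime_X_sub_C Function.injective_id hab)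
    fun a ha => dvd_iff_isRoot.2 (h a ha)

theorem aeval_X_pow_sub_X_eq_zero_iff {A : Type*} [Ring A] [Algebra F A] {q : ℕ} {b : A} :
    aeval b (X ^ q - X : F[X]) = 0 ↔ b ^ q = b := by
  simp [sub_eq_zero]

variable [Fintype F]

theorem pow_eq_self_of_card_sub_one_dvd {q : ℕ} (hq : 1 < q)
    (hdvd : (Fintype.card F - 1) ∣ (q - 1)) (a : F) : a ^ q = a := by
  rcases eq_or_ne a 0 with rfl | ha
  · exact zero_pow (by omega)
  · obtain ⟨k, hk⟩ := hdvd
    rw [show q = (q - 1) + 1 by omega, pow_succ, hk, pow_mul, FiniteField.pow_card_sub_one_eq_one a ha,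
      one_pow, one_mul]

open Classical in
theorem prod_erase_mul_dvd {q : ℕ} (hq : 1 < q) (hdvd : (Fintype.card F - 1) ∣ (q - 1)) (e : F) :
    (∏ a ∈ Finset.univ.erase e, (X - C a)) * (X - C e) ∣ (X ^ q - X : F[X]) := by
  rw [Finset.prod_erase_mul _ _ (Finset.mem_univ e)]
  exact prod_X_sub_C_dvd_of_isRoot fun a _ => by
    simp [pow_eq_self_of_card_sub_one_dvd hq hdvd a]

/-- In characteristic 2 with q = 2k + 1, X ^ q - X = X * (X ^ k - 1) ^ 2, so every nonzero element
is a double root. The last diagonal entry may therefore repeat an earlier one, provided that it is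
nonzero. -/
theorem prod_univ_mul_dvd {q : ℕ} (hq : 1 < q) (hodd : Odd q)
    (hdvd : (Fintype.card F - 1) ∣ (q - 1)) (h2 : (2 : F) = 0) {e : F} (he : e ≠ 0) :
    (∏ a : F, (X - C a)) * (X - C e) ∣ (X ^ q - X : F[X]) := by
  obtain ⟨k, hk⟩ := hodd
  have hroot : ∀ a : F, a ≠ 0 → a ^ k = 1 := by
    intro a ha
    have h1 : a ^ q = a := pow_eq_self_of_card_sub_one_dvd hq hdvd a
    have h3 : a * ((a ^ k - 1) * (a ^ k - 1)) = 0 := by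
      rw [hk] at h1
      linear_combination h1 - (a ^ (k + 1) - a) * h2
    have h4 := (mul_eq_zero.1 h3).resolve_left ha
    exact sub_eq_zero.1 (mul_self_eq_zero.1 h4)
  have h2' : (2 : F[X]) = 0 := by
    rw [← C_ofNat, h2, C_0]
  have hfac : (X ^ q - X : F[X]) = (X * (X ^ k - 1)) * (X ^ k - 1) := by
    rw [hk]
    linear_combination (X ^ (k + 1) - X) * h2'
  rw [hfac]
  refine mul_dvd_mul (prod_X_sub_C_dvd_of_isRoot fun a _ => ?_) (dvd_iff_isRoot.2 ?_)
  · rcases eq_or_ne a 0 with rfl | ha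
    · simp
    · simp [hroot a ha]
  · simp [hroot e he]

/-- The diagonal of the nilpotent splitting of a cyclic block of size `m + 1` and trace `c`. -/
theorem exists_diagonal_nilpotent {q : ℕ} (hq : 1 < q) (hodd : Odd q)
    (hdvd : (Fintype.card F - 1) ∣ (q - 1)) (hF : (2 : F) ≠ 0 → 3 < Fintype.card F) (m : ℕ) (c : F) :
    ∃ (d : ℕ → F) (S : Finset F), ∑ i ∈ Finset.range (m + 1), d i = c ∧ (∀ i < m, d i ∈ S) ∧
      (∏ a ∈ S, (X - C a)) * (X - C (d m)) ∣ (X ^ q - X : F[X]) := by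
  classical
  rcases Nat.eq_zero_or_pos m with rfl | hm
  · refine ⟨fun _ => c, ∅, by simp, by simp, ?_⟩
    rw [Finset.prod_empty, one_mul, dvd_iff_isRoot]
    simp [pow_eq_self_of_card_sub_one_dvd hq hdvd c]
  obtain ⟨e, S, hdiv, h0, h1⟩ : ∃ (e : F) (S : Finset F),
      (∏ a ∈ S, (X - C a)) * (X - C e) ∣ (X ^ q - X : F[X]) ∧ 0 ∈ S ∧ c - e ∈ S := by
    by_cases h2 : (2 : F) = 0
    · exact ⟨1, Finset.univ, prod_univ_mul_dvd hq hodd hdvd h2 one_ne_zero, by simp, by simp⟩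
    -- Avoiding 0 and c / 2 keeps the two remaining diagonal values 0 and c - e different from e.
    · obtain ⟨e, he⟩ := exists_notMem_of_card_lt (S := {0, c / 2})
        (Finset.card_le_two.trans_lt ((Nat.lt_succ_self 2).trans (hF h2)))
      simp only [Finset.mem_insert, Finset.mem_singleton, not_or] at he
      refine ⟨e, Finset.univ.erase e, prod_erase_mul_dvd hq hdvd e, ?_, ?_⟩
      · simpa using Ne.symm he.1
      · simp only [Finset.mem_erase, Finset.mem_univ, and_true]
        intro h
        exact he.2 (by field_simp; linear_combination -h)
  refine ⟨fun i => if i = m then e else if i = 0 then c - e else 0, S, ?_, ?_, ?_⟩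
  · rw [Finset.sum_range_succ, if_pos rfl, Finset.sum_congr rfl fun i hi =>
      if_neg (Finset.mem_range.1 hi).ne, Finset.sum_ite_eq', if_pos (Finset.mem_range.2 hm)]
    ring
  · intro i hi
    simp only [hi.ne, if_false]
    split_ifs <;> assumption
  · simpa using hdiv

/-- The shape of the idempotent splitting of a cyclic block of size `m + 1` and trace `c`: the
idempotent has diagonal `ε` and the subdiagonal entries selected by `ν`. -/
theorem exists_diagonal_idempotent {q : ℕ} (hq : 1 < q) (hodd : Odd q)
    (hdvd : (Fintype.card F - 1) ∣ (q - 1)) (hF : (2 : F) ≠ 0 → 3 < Fintype.card F) (m : ℕ) (c : F) :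
    ∃ (d ε : ℕ → F) (ν : ℕ → Prop) (S : Finset F),
      ∑ i ∈ Finset.range (m + 1), (d i + ε i) = c ∧ (∀ i < m, d i ∈ S) ∧
      (∀ i < m, ¬ ν i → i + 1 < m ∧ ν (i + 1) ∧ d i ≠ d (i + 1)) ∧
      (∏ a ∈ S, (X - C a)) * (X - C (d m)) ∣ (X ^ q - X : F[X]) ∧
      (∀ i ≤ m, ε i = 0 ∨ ε i = 1) ∧
      (∀ i < m, ν i → ε i = 0 ∧ ¬ ν (i + 1) ∧ ε (i + 1) = 1) := by
  classical
  rcases Nat.even_or_odd m with hm | hm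
  · rcases Nat.eq_zero_or_pos m with rfl | hm0
    · refine ⟨fun _ => c, fun _ => 0, fun _ => True, ∅, by simp, by simp, by simp, ?_, by simp,
        by simp⟩
      rw [Finset.prod_empty, one_mul, dvd_iff_isRoot]
      simp [pow_eq_self_of_card_sub_one_dvd hq hdvd c]
    -- For m even, the blocks of N are (1,2), ..., (m-1,m) and index 0 is free with idempotent entry
    -- t; the blocks of D are (0,1), ..., (m-2,m-1) with eigenvalues u, v.
    have key : ∃ (u v e t : F) (S : Finset F),
        (∏ a ∈ S, (X - C a)) * (X - C e) ∣ (X ^ q - X : F[X]) ∧ u ∈ S ∧ v ∈ S ∧ u ≠ v ∧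
        (t = 0 ∨ t = 1) ∧ ∑ i ∈ Finset.range m, (if Odd i then v else u) + e + t =
          c - ∑ i ∈ Finset.range m, (if Odd (i + 1) then (0 : F) else 1) := by
      set c' := c - ∑ i ∈ Finset.range m, (if Odd (i + 1) then (0 : F) else 1)
      by_cases h2 : (2 : F) = 0
      · set σ := ∑ i ∈ Finset.range m, (if Odd i then (1 : F) else 0)
        by_cases h : c' - σ = 0
        · refine ⟨0, 1, -1, 1, Finset.univ, prod_univ_mul_dvd hq hodd hdvd h2 (by simp), by simp,
            by simp, by simp, by simp, ?_⟩
          linear_combination -h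
        · refine ⟨0, 1, c' - σ, 0, Finset.univ, prod_univ_mul_dvd hq hodd hdvd h2 h, by simp,
            by simp, by simp, by simp, ?_⟩
          ring
      -- The eigenvalues x and -x cancel in pairs, leaving e = c'. The excluded values of x keep x,
      -- -x and c' distinct.
      · obtain ⟨x, hx⟩ := exists_notMem_of_card_lt (S := {0, c', -c'})
          (Finset.card_le_three.trans_lt (hF h2))
        simp only [Finset.mem_insert, Finset.mem_singleton, not_or] at hx
        obtain ⟨hx0, hx1, hx2⟩ := hx
        refine ⟨x, -x, c', 0, Finset.univ.erase c', prod_erase_mul_dvd hq hdvd c', by simpa,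
          by simpa using fun h => hx2 (neg_eq_iff_eq_neg.1 h), fun h => ?_, by simp, ?_⟩
        · have : 2 * x = 0 := by linear_combination h
          exact hx0 ((mul_eq_zero.1 this).resolve_left h2)
        · have hzero : ∀ k : ℕ, ∑ i ∈ Finset.range (k + k), (if Odd i then -x else x) = 0 := by
            intro k
            induction k with
            | zero => simp
            | succ k ih =>
              rw [show k + 1 + (k + 1) = k + k + 1 + 1 by ring, Finset.sum_range_succ,
                Finset.sum_range_succ, ih, if_neg (Nat.not_odd_iff_even.2 ⟨k, rfl⟩),
                if_pos (Even.add_one ⟨k, rfl⟩)]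
              ring
          obtain ⟨k, rfl⟩ := hm
          rw [hzero]
          ring
    obtain ⟨u, v, e, t, S, hdiv, hu, hv, huv, ht, hsum⟩ := key
    refine ⟨fun i => if i = m then e else if Odd i then v else u,
      fun i => if i = 0 then t else if Odd i then 0 else 1, fun i => Odd i, S, ?_, ?_, ?_, ?_, ?_, ?_⟩
    · rw [Finset.sum_add_distrib, Finset.sum_range_succ, if_pos rfl, Finset.sum_congr rfl fun i hi =>
        if_neg (Finset.mem_range.1 hi).ne, Finset.sum_range_succ']
      simp only [Nat.add_eq_zero_iff, one_ne_zero, and_false, if_false, if_true]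
      linear_combination hsum
    · intro i hi
      simp only [hi.ne, if_false]
      split_ifs <;> assumption
    · intro i hi hodd
      have hlt : i + 1 < m := by
        rcases (show i + 1 ≤ m from hi).lt_or_eq with h | rfl
        · exact h
        · exact absurd hm (by rw [Nat.not_even_iff_odd]; exact (Nat.not_odd_iff_even.1 hodd).add_one)
      have hodd' : Odd (i + 1) := (Nat.not_odd_iff_even.1 hodd).add_one
      refine ⟨hlt, hodd', ?_⟩
      simpa only [hi.ne, hlt.ne, hodd, hodd', if_false, if_true] using huv
    · simpa using hdiv
    · intro i _
      dsimp only
      split_ifs <;> simp [ht]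
    · intro i _ hi
      have h0 : i ≠ 0 := by rintro rfl; simp at hi
      have h1 : ¬ Odd (i + 1) := by rw [Nat.not_odd_iff_even]; exact hi.add_one
      simp [hi, h0, h1]
  -- For m odd, the blocks of N are (0,1), ..., (m-1,m) and those of D are (1,2), ..., (m-2,m-1).
  -- The entry y of D at index 0 is free and absorbs the trace.
  · obtain ⟨u, v, y, e, S, hdiv, hu, hv, huv, hy, hsum⟩ : ∃ (u v y e : F) (S : Finset F),
        (∏ a ∈ S, (X - C a)) * (X - C e) ∣ (X ^ q - X : F[X]) ∧ u ∈ S ∧ v ∈ S ∧ u ≠ v ∧ y ∈ S ∧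
        ∑ i ∈ Finset.range (m - 1), (if Odd (i + 1) then u else v) + y + e =
          c - ∑ i ∈ Finset.range (m + 1), (if Odd i then (1 : F) else 0) := by
      by_cases h2 : (2 : F) = 0
      · refine ⟨0, 1, c - ∑ i ∈ Finset.range (m + 1), (if Odd i then (1 : F) else 0) -
          ∑ i ∈ Finset.range (m - 1), (if Odd (i + 1) then (0 : F) else 1) - 1, 1, Finset.univ,
          prod_univ_mul_dvd hq hodd hdvd h2 one_ne_zero, by simp, by simp, by simp, by simp, ?_⟩
        ring
      · set c' := c - ∑ i ∈ Finset.range (m + 1), (if Odd i then (1 : F) else 0) -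
          ∑ i ∈ Finset.range (m - 1), (if Odd (i + 1) then (1 : F) else -1) with hc'
        obtain ⟨e, he⟩ := exists_notMem_of_card_lt (S := {1, -1, c' / 2})
          (Finset.card_le_three.trans_lt (hF h2))
        simp only [Finset.mem_insert, Finset.mem_singleton, not_or] at he
        refine ⟨1, -1, c' - e, e, Finset.univ.erase e, prod_erase_mul_dvd hq hdvd e,
          by simpa using Ne.symm he.1, by simpa using Ne.symm he.2.1, fun h => h2 ?_, ?_, ?_⟩
        · linear_combination h
        · simp only [Finset.mem_erase, Finset.mem_univ, and_true]
          intro h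
          exact he.2.2 (by field_simp; linear_combination -h)
        · rw [hc']
          ring
    have hm0 := hm.pos
    refine ⟨fun i => if i = m then e else if i = 0 then y else if Odd i then u else v,
      fun i => if Odd i then 1 else 0, fun i => ¬ Odd i, S, ?_, ?_, ?_, ?_, ?_, ?_⟩
    · obtain ⟨k, rfl⟩ : ∃ k, m = k + 1 := ⟨m - 1, by omega⟩
      rw [Finset.sum_add_distrib, Finset.sum_range_succ, if_pos rfl, Finset.sum_congr rfl fun i hi =>
        if_neg (Finset.mem_range.1 hi).ne, Finset.sum_range_succ']
      simp only [Nat.add_eq_zero_iff, one_ne_zero, and_false, if_false, if_true]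
      rw [Nat.add_sub_cancel] at hsum
      linear_combination hsum
    · intro i hi
      simp only [hi.ne, if_false]
      split_ifs <;> assumption
    · intro i hi hodd
      rw [not_not] at hodd
      have hodd' : ¬ Odd (i + 1) := by rw [Nat.not_odd_iff_even]; exact hodd.add_one
      have hlt : i + 1 < m := by
        rcases (show i + 1 ≤ m from hi).lt_or_eq with h | rfl
        · exact h
        · exact absurd hm hodd'
      refine ⟨hlt, hodd', ?_⟩
      simpa only [hi.ne, hlt.ne, hodd.pos.ne', hodd, hodd', Nat.add_eq_zero_iff, one_ne_zero,
        and_false, if_false, if_true] using huv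
    · simpa using hdiv
    · intro i _
      dsimp only
      split_ifs <;> simp
    · intro i _ hi
      have h1 : Odd (i + 1) := (Nat.not_odd_iff_even.1 hi).add_one
      simp [hi, h1]

theorem allIdempotentAddPotent_matrix {n : Type*} [Fintype n] [DecidableEq n] {q : ℕ} (hq : 1 < q)
    (hodd : Odd q) (hdvd : (Fintype.card F - 1) ∣ (q - 1))
    (hF : (2 : F) ≠ 0 → 3 < Fintype.card F) : AllIdempotentAddPotent (Matrix n n F) q := by
  classical
  intro A
  obtain ⟨N, D, hN, hD, rfl⟩ := exists_split_of_hasSplit (P := X ^ 2 - X) (r := X ^ q - X)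
    (fun p hp h0 _ => by
      obtain ⟨m, hm⟩ : ∃ m, p.natDegree = m + 1 := ⟨p.natDegree - 1, by omega⟩
      obtain ⟨d, ε, ν, S, hsum, hS, hν, hr, hε, hεν⟩ :=
        exists_diagonal_idempotent hq hodd hdvd hF m (-p.nextCoeff)
      exact hasSplit_of_diagonal hp hm hsum hS hν hr fun N β htop hN hNm =>
        aeval_sq_sub_self_eq_zero_of_chain htop hN hNm hε hεν) A
  refine ⟨N, D, ?_, aeval_X_pow_sub_X_eq_zero_iff.1 hD, rfl⟩
  rw [IsIdempotentElem, ← pow_two]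
  exact aeval_X_pow_sub_X_eq_zero_iff.1 hN

theorem allNilpotentAddPotent_matrix {n : Type*} [Fintype n] [DecidableEq n] {q : ℕ} (hq : 1 < q)
    (hodd : Odd q) (hdvd : (Fintype.card F - 1) ∣ (q - 1))
    (hF : (2 : F) ≠ 0 → 3 < Fintype.card F) : AllNilpotentAddPotent (Matrix n n F) q := by
  intro A
  obtain ⟨N, D, hN, hD, rfl⟩ := exists_split_of_hasSplit (P := X ^ Fintype.card n)
    (r := X ^ q - X) (fun p hp h0 hle => by
      obtain ⟨m, hm⟩ : ∃ m, p.natDegree = m + 1 := ⟨p.natDegree - 1, by omega⟩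
      obtain ⟨d, S, hsum, hS, hr⟩ := exists_diagonal_nilpotent hq hodd hdvd hF m (-p.nextCoeff)
      refine hasSplit_of_diagonal (d := d) (ε := fun _ => 0) (ν := fun _ => True) hp hm (by simpa)
        hS (by simp) hr fun N β htop hN hNm => ?_
      have := pow_eq_zero_of_chain htop (by simpa using hN) (by simpa using hNm)
      rw [map_pow, aeval_X]
      exact pow_eq_zero_of_le (hm ▸ hle) this) A
  exact ⟨N, D, ⟨Fintype.card n, by simpa using hN⟩, aeval_X_pow_sub_X_eq_zero_iff.1 hD, rfl⟩

theorem three_lt_card_of_two_ne_zero (h3 : IsEmpty (F ≃+* ZMod 3)) (h2 : (2 : F) ≠ 0) :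
    3 < Fintype.card F := by
  have h1 : 1 < Fintype.card F := Fintype.one_lt_card
  have hne2 : Fintype.card F ≠ 2 := fun h => h2 (by
    have := FiniteField.cast_card_eq_zero F
    rw [h] at this
    exact_mod_cast this)
  have hne3 : Fintype.card F ≠ 3 := fun h => by
    have : Fact (Nat.Prime 3) := ⟨Nat.prime_three⟩
    exact h3.false (FiniteField.ringEquivOfCardEq (h.trans (ZMod.card 3).symm))
  omega

end Diagonal

/-! ### The equivalences. -/

theorem theorem1p1 {R : Type*} [CommRing R] [IsDomain R] (q : ℕ) (hq : 1 < q) (hodd : Odd q)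
    (h3 : IsEmpty (R ≃+* ZMod 3)) (h5 : IsEmpty (R ≃+* ZMod 5))
    (h9 : IsEmpty (R ≃+* GaloisField 3 2)) :
    List.TFAE [
      ∀ n : ℕ, 1 ≤ n → AllIdempotentAddPotent (Matrix (Fin n) (Fin n) R) q,
      ∃ n : ℕ, 1 ≤ n ∧ AllIdempotentAddPotent (Matrix (Fin n) (Fin n) R) q,
      ∀ n : ℕ, 1 ≤ n → AllNilpotentAddPotent (Matrix (Fin n) (Fin n) R) q,
      ∃ n : ℕ, 1 ≤ n ∧ AllNilpotentAddPotent (Matrix (Fin n) (Fin n) R) q,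
      ∀ n : ℕ, 1 ≤ n → AllTripotentAddPotent (Matrix (Fin n) (Fin n) R) q,
      ∃ n : ℕ, 1 ≤ n ∧ AllTripotentAddPotent (Matrix (Fin n) (Fin n) R) q,
      ∀ n : ℕ, 1 ≤ n → AllPotentAddOrSubIdempotent (Matrix (Fin n) (Fin n) R) q,
      ∃ n : ℕ, 1 ≤ n ∧ AllPotentAddOrSubIdempotent (Matrix (Fin n) (Fin n) R) q,
      AllTripotentAddPotent R q,
      AllPotentAddOrSubIdempotent R q,
      Finite R ∧ IsField R ∧ (Nat.card R - 1) ∣ (q - 1)] := by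
  have field_imp : Finite R ∧ IsField R ∧ (Nat.card R - 1) ∣ (q - 1) →
      (∀ n : ℕ, AllIdempotentAddPotent (Matrix (Fin n) (Fin n) R) q) ∧
      (∀ n : ℕ, AllNilpotentAddPotent (Matrix (Fin n) (Fin n) R) q) ∧
      AllPotentAddOrSubIdempotent R q := by
    rintro ⟨hfin, hfield, hdvd⟩
    let _ := hfield.toField
    have := Fintype.ofFinite R
    rw [Nat.card_eq_fintype_card] at hdvd
    have hF := three_lt_card_of_two_ne_zero h3
    exact ⟨fun n => allIdempotentAddPotent_matrix hq hodd hdvd hF,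
      fun n => allNilpotentAddPotent_matrix hq hodd hdvd hF,
      fun a => ⟨a, 0, pow_eq_self_of_card_sub_one_dvd hq hdvd a, IsIdempotentElem.zero,
        Or.inl (add_zero a).symm⟩⟩
  tfae_have 1 → 2 := fun h => ⟨1, le_rfl, h 1 le_rfl⟩
  tfae_have 2 → 6 := fun ⟨n, hn, h⟩ => ⟨n, hn, h.allTripotentAddPotent⟩
  tfae_have 3 → 4 := fun h => ⟨1, le_rfl, h 1 le_rfl⟩
  tfae_have 4 → 9 := fun ⟨n, hn, h⟩ => by
    have : Nonempty (Fin n) := ⟨⟨0, hn⟩⟩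
    exact allTripotentAddPotent_of_matrix_nilpotent h
  tfae_have 1 → 5 := fun h n hn => (h n hn).allTripotentAddPotent
  tfae_have 5 → 6 := fun h => ⟨1, le_rfl, h 1 le_rfl⟩
  tfae_have 1 → 7 := fun h n hn => (h n hn).allPotentAddOrSubIdempotent
  tfae_have 7 → 8 := fun h => ⟨1, le_rfl, h 1 le_rfl⟩
  tfae_have 8 → 6 := fun ⟨n, hn, h⟩ => ⟨n, hn, h.allTripotentAddPotent⟩
  tfae_have 6 → 9 := fun ⟨n, hn, h⟩ => by
    have : Nonempty (Fin n) := ⟨⟨0, hn⟩⟩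
    exact allTripotentAddPotent_of_matrix h
  tfae_have 10 → 9 := fun h => h.allTripotentAddPotent
  tfae_have 9 → 11 := isField_and_card_dvd_of_allTripotentAddPotent hq hodd h5 h9
  tfae_have 11 → 1 := fun h n _ => (field_imp h).1 n
  tfae_have 11 → 3 := fun h n _ => (field_imp h).2.1 n
  tfae_have 11 → 10 := fun h => (field_imp h).2.2
  tfae_finish
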